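/- Let $k\ge 1$ be an integer, let $\mathbb{F}_{2^{2k}}$ be the finite field with $2^{2k}$ elements, and let $\mathrm{Tr}:\mathbb{F}_{2^{2k}}\to\mathbb{F}_2$ be the absolute trace. A function $f:\mathbb{F}_{2^{2k}}\to\mathbb{F}_2$ is called bent if $$\sum_{x\in\mathbb{F}_{2^{2k}}}(-1)^{f(x)+\mathrm{Tr}(\lambda x)}\in\{2^k,-2^k\}\quad\text{for every }\lambda\in\mathbb{F}_{2^{2k}},$$ and the number of bent components of a function $F:\mathbb{F}_{2^{2k}}\to\mathbb{F}_{2^{2k}}$ is the number of $\alpha\in\mathbb{F}_{2^{2k}}$ for which $x\mapsto \mathrm{Tr}(\alpha F(x))$ is bent. Theorem. Let $d=(2^k+1)s$ with $0<s<2^k-1$ and $\gcd(s,2^k-1)>1$. Then the number of bent components of the function $F(x)=x^d$ on $\mathbb{F}_{2^{2k}}$ is not equal to $2^{2k}-2^k$. -/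

import Mathlib

noncomputable section

/-- The Walsh (Hadamard) transform of a Boolean function `f` on a finite field `F` of
characteristic `2`, at `lam`: the sum over `x` of `(-1) ^ (f x + Tr (lam * x))`, where `Tr` is the
absolute trace from `F` to the field with two elements. -/
def walshTransform {F : Type*} [Field F] [Fintype F] [Algebra (ZMod 2) F]
    (f : F → ZMod 2) (lam : F) : ℤ :=
  ∑ x : F, (-1 : ℤ) ^ (f x + Algebra.trace (ZMod 2) F (lam * x)).val

/-- A Boolean function on a field `F` with `2 ^ n` elements is bent if all values of its Walsh
transform are `2 ^ (n / 2)` or `- 2 ^ (n / 2)` (real exponent), that is, plus or minus the square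
root of the number of elements of `F`. -/
def IsBent {F : Type*} [Field F] [Fintype F] [Algebra (ZMod 2) F] (f : F → ZMod 2) : Prop :=
  ∀ lam : F, (walshTransform f lam : ℝ) = √(Fintype.card F : ℝ) ∨
    (walshTransform f lam : ℝ) = -√(Fintype.card F : ℝ)

/-- The component `x ↦ Tr (α * G x)` of the vectorial function `G` at `α`. -/
def component {F : Type*} [Field F] [Algebra (ZMod 2) F] (G : F → F) (α : F) : F → ZMod 2 :=
  fun x => Algebra.trace (ZMod 2) F (α * G x)

/-- The number of bent components of `G`, i.e. the number of field elements `α` such that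
`x ↦ Tr (α * G x)` is bent. -/
def numBentComponents {F : Type*} [Field F] [Fintype F] [Algebra (ZMod 2) F] (G : F → F) : ℕ :=
  {α : F | IsBent (component G α)}.ncard

end

/-! Put q = 2^k. The sum over α of the squared Walsh values at 0 equals q² times the number of pairs
with x^d = y^d (`sum_walshTransform_zero_sq`). Bent components contribute q² each and the others at
most q⁴, so q² - q bent components allow at most q³ + q² - q collisions. But gcd(q² - 1, d) = (q +
1) gcd(q - 1, s) ≥ 2(q + 1) forces at least 2(q² - 1)(q + 1), which is larger. -/

/-- The canonical additive character `x ↦ (-1) ^ Tr x` of a finite field of characteristic `2`,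
with integer values. -/
noncomputable def traceSignChar (F : Type*) [Field F] [Algebra (ZMod 2) F] : AddChar F ℤ where
  toFun x := (-1) ^ (Algebra.trace (ZMod 2) F x).val
  map_zero_eq_one' := by simp
  map_add_eq_mul' x y := by
    rw [map_add]
    generalize Algebra.trace (ZMod 2) F x = a
    generalize Algebra.trace (ZMod 2) F y = b
    revert a b
    decide

theorem traceSignChar_isPrimitive (F : Type*) [Field F] [Finite F] [Algebra (ZMod 2) F] :
    (traceSignChar F).IsPrimitive := by
  intro a ha h
  obtain ⟨b, hb⟩ : ∃ b : F, Algebra.trace (ZMod 2) F (a * b) ≠ 0 := by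
    by_contra! hf
    exact ha ((traceForm_nondegenerate (ZMod 2) F).1 a hf)
  have h1 : (-1 : ℤ) ^ (Algebra.trace (ZMod 2) F (a * b)).val = 1 := DFunLike.congr_fun h b
  revert hb h1
  generalize Algebra.trace (ZMod 2) F (a * b) = c
  revert c
  decide

theorem walshTransform_component_zero {F : Type*} [Field F] [Fintype F] [Algebra (ZMod 2) F]
    (G : F → F) (α : F) :
    walshTransform (component G α) 0 = ∑ x, traceSignChar F (α * G x) := by
  simp [walshTransform, component, traceSignChar]

theorem traceSignChar_sub {F : Type*} [Field F] [Algebra (ZMod 2) F] (x y : F) :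
    traceSignChar F (x - y) = traceSignChar F x * traceSignChar F y := by
  have : CharP F 2 := charP_of_injective_algebraMap (algebraMap (ZMod 2) F).injective 2
  rw [CharTwo.sub_eq_add, AddChar.map_add_eq_mul]

/-- The second moment of the component sums counts the collisions of `G`. -/
theorem sum_walshTransform_zero_sq {F : Type*} [Field F] [Fintype F] [DecidableEq F]
    [Algebra (ZMod 2) F] (G : F → F) :
    ∑ α, walshTransform (component G α) 0 ^ 2 =
      Fintype.card F * ((Finset.univ.filter fun p : F × F => G p.1 = G p.2).card : ℤ) := by
  have h (α : F) : walshTransform (component G α) 0 ^ 2 =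
      ∑ p : F × F, traceSignChar F (α * (G p.1 - G p.2)) := by
    rw [walshTransform_component_zero, sq, Finset.sum_mul_sum, Fintype.sum_prod_type]
    simp only [mul_sub, traceSignChar_sub]
  simp_rw [h]
  rw [Finset.sum_comm]
  simp_rw [AddChar.sum_mulShift _ (traceSignChar_isPrimitive F), sub_eq_zero]
  push_cast
  rw [← Finset.sum_filter, Finset.sum_const, nsmul_eq_mul, mul_comm]

theorem abs_walshTransform_le {F : Type*} [Field F] [Fintype F] [Algebra (ZMod 2) F]
    (f : F → ZMod 2) (lam : F) : |walshTransform f lam| ≤ Fintype.card F := by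
  refine (Finset.abs_sum_le_sum_abs _ _).trans ?_
  simp

theorem IsBent.walshTransform_sq {F : Type*} [Field F] [Fintype F] [Algebra (ZMod 2) F]
    {f : F → ZMod 2} (hf : IsBent f) (lam : F) :
    walshTransform f lam ^ 2 = Fintype.card F := by
  have : (walshTransform f lam : ℝ) ^ 2 = Fintype.card F := by
    rcases hf lam with h | h <;> rw [h] <;> simp
  exact_mod_cast this

theorem sum_walshTransform_zero_sq_le {F : Type*} [Field F] [Fintype F]
    [Algebra (ZMod 2) F] (G : F → F) :
    ∑ α, walshTransform (component G α) 0 ^ 2 ≤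
      numBentComponents G * (Fintype.card F : ℤ) +
        (Fintype.card F - numBentComponents G) * (Fintype.card F : ℤ) ^ 2 := by
  classical
  have hN : numBentComponents G = (Finset.univ.filter fun α => IsBent (component G α)).card := by
    rw [numBentComponents, Set.ncard_eq_toFinset_card', Set.toFinset_ofPred]
  have hc : ((Finset.univ.filter fun α => ¬ IsBent (component G α)).card : ℤ) =
      Fintype.card F - numBentComponents G := by
    have := Finset.card_filter_add_card_filter_not (s := (Finset.univ : Finset F))
      (fun α => IsBent (component G α))
    rw [Finset.card_univ] at this
    rw [hN, ← this]
    push_cast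
    ring
  rw [← Finset.sum_filter_add_sum_filter_not _ fun α => IsBent (component G α), ← hc, hN,
    ← nsmul_eq_mul, ← nsmul_eq_mul]
  refine add_le_add (Finset.sum_le_card_nsmul _ _ _ fun α hα => ?_)
    (Finset.sum_le_card_nsmul _ _ _ fun α _ => ?_)
  · exact ((Finset.mem_filter.1 hα).2.walshTransform_sq 0).le
  · exact sq_le_sq' (abs_le.1 (abs_walshTransform_le _ _)).1 (abs_le.1 (abs_walshTransform_le _ _)).2

/-- The pairs (x, xz) with x ≠ 0 and z^d = 1 collide; the cyclic group of units has gcd(|F| - 1, d)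
such z. -/
theorem card_sub_one_mul_gcd_le_card_collisions {F : Type*} [Field F] [Fintype F] [DecidableEq F]
    (d : ℕ) :
    (Fintype.card F - 1) * (Fintype.card F - 1).gcd d ≤
      (Finset.univ.filter fun p : F × F => p.1 ^ d = p.2 ^ d).card := by
  rw [← Fintype.card_units, ← Nat.card_eq_fintype_card (α := Fˣ),
    ← IsCyclic.card_powMonoidHom_ker (G := Fˣ) d, ← Nat.card_prod, Nat.card_eq_fintype_card,
    ← Finset.card_univ]
  refine Finset.card_le_card_of_injOn (fun p => ((p.1 : F), ((p.1 * (p.2 : Fˣ) : Fˣ) : F))) ?_ ?_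
  · rintro ⟨x, z, hz⟩ -
    have hz' : (z : F) ^ d = 1 := congrArg Units.val (MonoidHom.mem_ker.1 hz)
    simp [mul_pow, hz']
  · rintro ⟨x, z⟩ - ⟨y, w⟩ - h
    obtain ⟨h1, h2⟩ := Prod.mk.inj h
    obtain rfl : x = y := Units.ext h1
    have : (z : Fˣ) = w := mul_left_cancel (Units.ext h2)
    rw [Subtype.ext this]

theorem mainTheorem6 {F : Type*} [Field F] [Fintype F] [Algebra (ZMod 2) F]
    (k s d : ℕ) (hF : Fintype.card F = 2 ^ (2 * k))
    (hd : d = (2 ^ k + 1) * s) (hs0 : 0 < s) (hs : s < 2 ^ k - 1)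
    (hgcd : 1 < Nat.gcd s (2 ^ k - 1)) :
    numBentComponents (fun x : F => x ^ d) ≠ 2 ^ (2 * k) - 2 ^ k := by
  classical
  intro hN
  have h1 := sum_walshTransform_zero_sq_le (fun x : F => x ^ d)
  rw [sum_walshTransform_zero_sq, hN] at h1
  have h2 := card_sub_one_mul_gcd_le_card_collisions (F := F) d
  set P := (Finset.univ.filter fun p : F × F => p.1 ^ d = p.2 ^ d).card
  rw [hF, mul_comm 2 k, pow_mul] at h1 h2
  -- From here on only q ≥ 2 matters, which `hs` supplies; r = q - 1 avoids truncated subtraction.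
  generalize 2 ^ k = q at *
  obtain ⟨r, rfl⟩ : ∃ r, q = r + 1 := ⟨q - 1, by omega⟩
  have hr : 0 < r := by omega
  have e1 : (r + 1) ^ 2 - 1 = (r + 2) * r := by
    rw [Nat.sub_eq_iff_eq_add (Nat.one_le_pow _ _ (by omega))]; ring
  have e2 : (((r + 1) ^ 2 - (r + 1) : ℕ) : ℤ) = (r + 1) * r := by
    rw [show (r + 1) ^ 2 - (r + 1) = (r + 1) * r by
      rw [Nat.sub_eq_iff_eq_add (Nat.le_self_pow two_ne_zero _)]; ring]
    push_cast; rfl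
  rw [e2] at h1
  rw [e1, hd, add_assoc, Nat.gcd_mul_left, Nat.gcd_comm] at h2
  rw [Nat.add_sub_cancel] at hgcd
  -- The factor 2 is the lower bound on gcd(s, q - 1).
  have h3 : ((r + 2) * r * ((r + 2) * 2) : ℤ) ≤ P := by
    have := (Nat.mul_le_mul_left ((r + 2) * r) (Nat.mul_le_mul_left (r + 2) hgcd)).trans h2
    exact_mod_cast this
  push_cast at h1
  have h4 := mul_le_mul_of_nonneg_left h3 (sq_nonneg ((r : ℤ) + 1))
  have h5 : (0 : ℤ) < r := by exact_mod_cast hr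
  have h6 := h4.trans h1
  -- Up to the factor q², the contradiction is q³ + q² - q - 2 > 0 for q ≥ 2.
  nlinarith [pow_pos h5 2, pow_pos h5 3, pow_pos h5 4, pow_pos h5 5]
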